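/- Let $(S,\mathcal S,Q)$ be a probability space and let $h:S\times\mathbb R\to\mathbb R$ be such that $h(\cdot,t)$ is measurable for every $t\in\mathbb R$, $h(x,\cdot)$ is convex for every $x\in S$, and $\int_S|D^{\pm}h(x,t)|\,Q(dx)<\infty$ for every $t\in\mathbb R$, where $D^+$ and $D^-$ denote the right and the left derivative in the real variable. Fix $t_0\in\mathbb R$, put $$M(t)=\int_S \big(h(x,t)-h(x,t_0)\big)\,Q(dx),\qquad t\in\mathbb R,$$ and let $m\in\mathbb R$ be a minimizing point of $M$. Let $X_1,X_2,\dots$ be i.i.d. $S$-valued random variables with distribution $Q$ on a probability space $(\Omega,\mathcal A,\mathbb P)$, and for $k\ge1$ let $\hat m_k$ be the smallest minimizing point of $$M_k(t)=\frac1k\sum_{i=1}^k\big(h(X_i,t)-h(X_i,t_0)\big),\qquad t\in\mathbb R$$ (at outcomes for which $M_k$ has no smallest minimizing point, $\hat m_k$ may be any real number). Suppose that there are constants $c,\delta>0$ with $$|D^+M(m+x)|\ge c\,|x|\qquad\text{for all }x\in[-\delta,\delta],$$ and that there are $s>2$ and $x_0>0$ with $$\sup_{|x|\le x_0}\mathbb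 E\big[|D^+h(X_1,m+x)|^s\big]<\infty .$$ Then $\sup_{k\ge n}|\hat m_k-m|=o(n^{-\gamma})$ $\mathbb P$-$r$-completely, that is, $$\sum_{n=1}^\infty n^{r-1}\,\mathbb P\Big(n^\gamma\sup_{k\ge n}|\hat m_k-m|>\epsilon\Big)<\infty\qquad\text{for all }\epsilon>0,$$ for all real $\gamma<\tfrac12$ and all real $r<(\tfrac12-\gamma)s$ that also satisfy $r<\tfrac s2$ (the last condition is automatic if $\gamma\ge0$). -/

import Mathlib

open MeasureTheory ProbabilityTheory Set
open scoped ENNReal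

namespace ConvexMEstimation

/-- The right derivative `D⁺f(t)`. -/
noncomputable def rightDer (f : ℝ → ℝ) (t : ℝ) : ℝ := derivWithin f (Ioi t) t

/-- The left derivative `D⁻f(t)`. -/
noncomputable def leftDer (f : ℝ → ℝ) (t : ℝ) : ℝ := derivWithin f (Iio t) t

/-- The set of all (global) minimizing points of `f : ℝ → ℝ`. -/
def minimizers (f : ℝ → ℝ) : Set ℝ := {t | ∀ u, f t ≤ f u}

/-- The criterion function `M(t) = ∫ (h(x,t) - h(x,t₀)) Q(dx)`. -/
noncomputable def criterion {S : Type*} [MeasurableSpace S]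
    (h : S → ℝ → ℝ) (t₀ : ℝ) (Q : Measure S) (t : ℝ) : ℝ :=
  ∫ x, (h x t - h x t₀) ∂Q

/-- The empirical criterion function `M_k(t) = (1/k) ∑ (h(X_i,t) - h(X_i,t₀))` of the first `k`
observations, evaluated at the outcome `ω`. The sequence of observations is indexed from `0`, so
that the sample of size `k` is `X 0, …, X (k - 1)`. -/
noncomputable def empCriterion {S Ω : Type*}
    (h : S → ℝ → ℝ) (t₀ : ℝ) (X : ℕ → Ω → S) (k : ℕ) (ω : Ω) (t : ℝ) : ℝ :=
  (k : ℝ)⁻¹ * ∑ i ∈ Finset.range k, (h (X i ω) t - h (X i ω) t₀)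

/-- `sup_{k ≥ n} |Y_k - m|`, as an extended nonnegative number (it may be infinite). -/
noncomputable def supDev {Ω : Type*} (Y : ℕ → Ω → ℝ) (m : ℝ) (n : ℕ) (ω : Ω) : ℝ≥0∞ :=
  ⨆ k : ℕ, ⨆ _ : n ≤ k, ENNReal.ofReal |Y k ω - m|

/-- `r`-complete convergence to `0` of a sequence `Z_1, Z_2, …` of nonnegative, possibly infinite,
random variables: `∑_{n ≥ 1} n^(r-1) P(Z_n > ε) < ∞` for every `ε > 0`. The summation index is
shifted by one; the series is a series in `[0, ∞]`. -/
def TendsToZeroRCompletely {Ω : Type*} [MeasurableSpace Ω] (P : Measure Ω) (r : ℝ)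
    (Z : ℕ → Ω → ℝ≥0∞) : Prop :=
  ∀ ε : ℝ, 0 < ε →
    (∑' n : ℕ, ENNReal.ofReal (((n + 1 : ℕ) : ℝ) ^ (r - 1)) *
      P {ω | ENNReal.ofReal ε < Z (n + 1) ω}) < ∞

/-- `Z_n = o(n^(-γ))` `P`-`r`-completely: `n^γ Z_n` converges `r`-completely to `0`. -/
def IsLittleORCompletely {Ω : Type*} [MeasurableSpace Ω] (P : Measure Ω) (r γ : ℝ)
    (Z : ℕ → Ω → ℝ≥0∞) : Prop :=
  TendsToZeroRCompletely P r fun n ω => ENNReal.ofReal ((n : ℝ) ^ γ) * Z n ω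

end ConvexMEstimation

namespace ConvexMEstimation

/-! ### Convex functions on the line and their right derivatives -/

/-! Convexity turns the location of a minimizing point into two signs: if D⁺M_k(m - x) < 0 < D⁺M_k(m
+ x), then M_k has a smallest minimizing point and it lies in [m - x, m + x]. Here D⁺M_k(t) is the
average of the i.i.d. variables D⁺h(X_i, t), whose mean is D⁺M(t) (`rightDer_criterion`). Minimality
of m and the linear lower bound give D⁺M(m - x) ≤ -cx and D⁺M(m + x) ≥ cx. A deviation beyond x for
some k ≥ n thus forces, at one of the two points m ± x, an average of some k ≥ n terms to be at
least cx away from its mean.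

The probability of this is at most a constant times (cx)^(-s) n^(-s/2). The moment inequality
E|S_n|^s ≤ B n^(s/2) (`exists_integral_abs_sum_rpow_le`) is combined with Doob's inequality on
dyadic blocks of k, whose contributions decay geometrically (`measure_exists_mul_le_abs_sum_le`).
The constant must not depend on the point m ± x, because x varies with n; this is where the uniform
moment bound enters.

With x = ρ n^(-γ') and γ' = max γ 0, the n-th term of the series is O(n^(r - 1 + γ's - s/2)). This
bound is summable when r < (1/2 - γ')s, which is the conjunction of the two conditions on r. -/

lemma hasDerivWithinAt_rightDer {f : ℝ → ℝ} (hf : ConvexOn ℝ univ f) (t : ℝ) :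
    HasDerivWithinAt f (rightDer f t) (Ioi t) t :=
  hf.hasDerivWithinAt_rightDeriv_of_mem_interior (by simp)

/-- The right derivative of a convex function is a subgradient. -/
lemma add_rightDer_mul_le {f : ℝ → ℝ} (hf : ConvexOn ℝ univ f) (t u : ℝ) :
    f t + rightDer f t * (u - t) ≤ f u := by
  rcases lt_trichotomy t u with htu | rfl | hut
  · have h := hf.rightDeriv_le_slope_of_mem_interior (x := t) (by simp) (mem_univ u) htu
    rw [slope_def_field, le_div_iff₀ (by linarith)] at h
    unfold rightDer
    linarith
  · simp
  · have h := (hf.slope_le_leftDeriv_of_mem_interior (mem_univ u) (y := t) (by simp) hut).trans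
      (hf.leftDeriv_le_rightDeriv_of_mem_interior (by simp))
    rw [slope_def_field, div_le_iff₀ (by linarith)] at h
    unfold rightDer
    linarith

lemma continuous_of_convexOn_univ {f : ℝ → ℝ} (hf : ConvexOn ℝ univ f) : Continuous f :=
  continuousOn_univ.1 (hf.continuousOn isOpen_univ)

/-- A convex function whose right derivative changes sign from `a` to `b` has a smallest
minimizing point, which lies between `a` and `b`. -/
lemma exists_isLeast_minimizers {f : ℝ → ℝ} (hf : ConvexOn ℝ univ f) {a b : ℝ}
    (ha : rightDer f a < 0) (hb : 0 < rightDer f b) :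
    ∃ t ∈ Icc a b, IsLeast (minimizers f) t := by
  -- By the subgradient inequality, f exceeds f a to the left of a and f b to the right of b, so a
  -- minimum over [a, b] is global.
  have hleft : ∀ u, u < a → f a < f u := fun u hu => by
    nlinarith [add_rightDer_mul_le hf a u, mul_pos_of_neg_of_neg ha (sub_neg.2 hu)]
  have hright : ∀ u, b < u → f b < f u := fun u hu => by
    nlinarith [add_rightDer_mul_le hf b u, mul_pos hb (sub_pos.2 hu)]
  have hab : a ≤ b := by
    by_contra! h
    exact lt_asymm (hleft b h) (hright a h)
  have hcont := continuous_of_convexOn_univ hf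
  obtain ⟨p, hp, hpmin⟩ := isCompact_Icc.exists_isMinOn (nonempty_Icc.2 hab) hcont.continuousOn
  have hpglob : p ∈ minimizers f := fun u => by
    rcases lt_or_ge u a with hu | hu
    · exact (hpmin (left_mem_Icc.2 hab)).trans (hleft u hu).le
    rcases lt_or_ge b u with hu' | hu'
    · exact (hpmin (right_mem_Icc.2 hab)).trans (hright u hu').le
    · exact hpmin ⟨hu, hu'⟩
  have hsub : minimizers f ⊆ Icc a b := fun t ht =>
    ⟨not_lt.1 fun h => not_le.2 (hleft t h) (ht a), not_lt.1 fun h => not_le.2 (hright t h) (ht b)⟩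
  have hclosed : IsClosed (minimizers f) := by
    simp only [minimizers, ofPred_forall]
    exact isClosed_iInter fun u => isClosed_le hcont continuous_const
  obtain ⟨t, ht⟩ := (isCompact_Icc.of_isClosed_subset hclosed hsub).exists_isLeast ⟨p, hpglob⟩
  exact ⟨t, hsub ht.1, ht⟩

/-! ### The empirical criterion function: convexity and right derivative -/

section Empirical

variable {S Ω : Type*} {h : S → ℝ → ℝ}

lemma convexOn_empCriterion (h_convex : ∀ x, ConvexOn ℝ univ (h x)) (t₀ : ℝ) (X : ℕ → Ω → S)
    (k : ℕ) (ω : Ω) : ConvexOn ℝ univ (empCriterion h t₀ X k ω) := by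
  have hsum : ∀ s : Finset ℕ,
      ConvexOn ℝ univ fun t => ∑ i ∈ s, (h (X i ω) t - h (X i ω) t₀) := fun s => by
    classical
    induction s using Finset.induction_on with
    | empty => simpa using convexOn_const (0 : ℝ) (convex_univ (𝕜 := ℝ) (E := ℝ))
    | insert i s hi ih =>
      simp only [Finset.sum_insert hi]
      refine ConvexOn.add ?_ ih
      simp only [sub_eq_add_neg]
      exact (h_convex (X i ω)).add_const (-h (X i ω) t₀)
  exact (hsum _).smul (inv_nonneg.2 k.cast_nonneg)

lemma rightDer_empCriterion (h_convex : ∀ x, ConvexOn ℝ univ (h x)) (t₀ : ℝ) (X : ℕ → Ω → S)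
    (k : ℕ) (ω : Ω) (t : ℝ) :
    rightDer (empCriterion h t₀ X k ω) t
      = (k : ℝ)⁻¹ * ∑ i ∈ Finset.range k, rightDer (h (X i ω)) t := by
  refine HasDerivWithinAt.derivWithin ?_ (uniqueDiffWithinAt_Ioi t)
  exact (HasDerivWithinAt.fun_sum fun i _ =>
    (hasDerivWithinAt_rightDer (h_convex (X i ω)) t).sub_const _).const_mul _

end Empirical

/-! ### The criterion function: integrability and differentiation under the integral -/

section Criterion

variable {S : Type*} [MeasurableSpace S] {Q : Measure S} {h : S → ℝ → ℝ}

lemma tendsto_slope_rightDer {f : ℝ → ℝ} (hf : ConvexOn ℝ univ f) (t : ℝ) :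
    Filter.Tendsto (fun n : ℕ => slope f t (t + 1 / ((n : ℝ) + 1))) Filter.atTop
      (nhds (rightDer f t)) := by
  refine ((hasDerivWithinAt_iff_tendsto_slope' self_notMem_Ioi).1
    (hasDerivWithinAt_rightDer hf t)).comp (tendsto_nhdsWithin_iff.2 ⟨?_, ?_⟩)
  · simpa using (tendsto_one_div_add_atTop_nhds_zero_nat (𝕜 := ℝ)).const_add t
  · exact Filter.Eventually.of_forall fun n => by
      simpa using (by positivity : (0 : ℝ) < (n : ℝ) + 1)

lemma measurable_rightDer (h_meas : ∀ t, Measurable fun x => h x t)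
    (h_convex : ∀ x, ConvexOn ℝ univ (h x)) (t : ℝ) : Measurable fun x => rightDer (h x) t := by
  refine measurable_of_tendsto_metrizable (f := fun (n : ℕ) x => slope (h x) t (t + 1 / ((n : ℝ) + 1)))
    (fun n => ?_) (tendsto_pi_nhds.2 fun x => tendsto_slope_rightDer (h_convex x) t)
  simp only [slope_def_field]
  exact ((h_meas _).sub (h_meas _)).div_const _

/-- The subgradient inequalities at t₀ and at t trap the increment between D⁺h(x, t₀)(t - t₀) and
D⁺h(x, t)(t - t₀), both integrable. -/
lemma integrable_sub_of_integrable_rightDer (h_meas : ∀ t, Measurable fun x => h x t)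
    (h_convex : ∀ x, ConvexOn ℝ univ (h x))
    (h_right : ∀ t, Integrable (fun x => rightDer (h x) t) Q) (t t₀ : ℝ) :
    Integrable (fun x => h x t - h x t₀) Q := by
  refine Integrable.mono' (((h_right t).mul_const (t - t₀)).abs.add
    ((h_right t₀).mul_const (t - t₀)).abs)
    ((h_meas t).sub (h_meas t₀)).aestronglyMeasurable (.of_forall fun x => ?_)
  have h1 := add_rightDer_mul_le (h_convex x) t t₀
  have h2 := add_rightDer_mul_le (h_convex x) t₀ t
  simp only [Real.norm_eq_abs, Pi.add_apply]
  rw [abs_le]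
  constructor
  · linarith [neg_abs_le (rightDer (h x) t₀ * (t - t₀)), abs_nonneg (rightDer (h x) t * (t - t₀))]
  · linarith [le_abs_self (rightDer (h x) t * (t - t₀)), abs_nonneg (rightDer (h x) t₀ * (t - t₀))]

/-- Integrated subgradient inequality for the criterion function. -/
lemma criterion_add_le (h_meas : ∀ t, Measurable fun x => h x t)
    (h_convex : ∀ x, ConvexOn ℝ univ (h x))
    (h_right : ∀ t, Integrable (fun x => rightDer (h x) t) Q) (t₀ t u : ℝ) :
    criterion h t₀ Q t + (∫ x, rightDer (h x) t ∂Q) * (u - t) ≤ criterion h t₀ Q u := by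
  have hint := fun v => integrable_sub_of_integrable_rightDer h_meas h_convex h_right v t₀
  unfold criterion
  rw [← integral_mul_const, ← integral_add (hint t) ((h_right t).mul_const _)]
  refine integral_mono ((hint t).add ((h_right t).mul_const _)) (hint u) fun x => ?_
  have := add_rightDer_mul_le (h_convex x) t u
  linarith

/-- Differentiation of the criterion function under the integral sign. -/
lemma rightDer_criterion (h_meas : ∀ t, Measurable fun x => h x t)
    (h_convex : ∀ x, ConvexOn ℝ univ (h x))
    (h_right : ∀ t, Integrable (fun x => rightDer (h x) t) Q) (t₀ t : ℝ) :
    rightDer (criterion h t₀ Q) t = ∫ x, rightDer (h x) t ∂Q := by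
  have hint := fun v => integrable_sub_of_integrable_rightDer h_meas h_convex h_right v t₀
  refine HasDerivWithinAt.derivWithin ?_ (uniqueDiffWithinAt_Ioi t)
  rw [hasDerivWithinAt_iff_tendsto_slope' self_notMem_Ioi]
  have hslope : slope (criterion h t₀ Q) t = fun u => ∫ x, slope (h x) t u ∂Q := funext fun u => by
    simp only [slope_def_field, criterion, integral_div]
    rw [← integral_sub (hint u) (hint t)]
    simp
  rw [hslope]
  refine tendsto_integral_filter_of_dominated_convergence
    (fun x => |rightDer (h x) t| + |rightDer (h x) (t + 1)|) ?_ ?_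
    ((h_right t).abs.add (h_right (t + 1)).abs) ?_
  · refine .of_forall fun u => ?_
    simp only [slope_def_field]
    exact (((h_meas u).sub (h_meas t)).div_const _).aestronglyMeasurable
  -- For t < u < t + 1 the slope lies between D⁺h(x, t) and D⁺h(x, t + 1), which gives the
  -- dominating function.
  · filter_upwards [Ioo_mem_nhdsGT (show t < t + 1 by linarith)] with u hu
    refine .of_forall fun x => ?_
    have h1 := add_rightDer_mul_le (h_convex x) t u
    have h2 := add_rightDer_mul_le (h_convex x) u t
    have h3 := add_rightDer_mul_le (h_convex x) u (t + 1)
    have h4 := add_rightDer_mul_le (h_convex x) (t + 1) u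
    have hut : 0 < u - t := sub_pos.2 hu.1
    have hmono : rightDer (h x) u ≤ rightDer (h x) (t + 1) := by
      have : 0 < t + 1 - u := sub_pos.2 hu.2
      nlinarith
    rw [slope_def_field, Real.norm_eq_abs, abs_le, le_div_iff₀ hut, div_le_iff₀ hut]
    constructor
    · nlinarith [neg_abs_le (rightDer (h x) t), abs_nonneg (rightDer (h x) (t + 1))]
    · nlinarith [le_abs_self (rightDer (h x) (t + 1)), abs_nonneg (rightDer (h x) t)]
  · exact .of_forall fun x => (hasDerivWithinAt_iff_tendsto_slope' self_notMem_Ioi).1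
      (hasDerivWithinAt_rightDer (h_convex x) t)

end Criterion

/-! ### A moment inequality for sums of independent centered random variables -/

/-- This is the tangent line inequality for the convex power at v, evaluated at 1; it is Bernoulli's
inequality at 1/v, multiplied by v ^ p. -/
lemma rpow_le_one_add_mul_sub_one_mul {v p : ℝ} (hv : 0 < v) (hp : 1 ≤ p) :
    v ^ p ≤ 1 + p * (v - 1) * v ^ (p - 1) := by
  have h := one_add_mul_self_le_rpow_one_add (s := v⁻¹ - 1) (by linarith [inv_pos.2 hv]) hp
  have hvp : 0 < v ^ p := Real.rpow_pos_of_pos hv p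
  rw [add_sub_cancel, Real.inv_rpow hv.le] at h
  have h2 := mul_le_mul_of_nonneg_left h hvp.le
  rw [mul_inv_cancel₀ hvp.ne'] at h2
  have h3 : v ^ p = v ^ (p - 1) * v := by
    rw [← Real.rpow_add_one hv.ne']; congr 1; ring
  have h4 : v ^ p * v⁻¹ = v ^ (p - 1) := by rw [h3, mul_inv_cancel_right₀ hv.ne']
  nlinarith

/-- After the tangent inequality at 1 + u, only u((1 + u)^(s-1) - 1) has to be of order u². For u ≥
0 the same inequality with exponent s - 1 gives this; for u ≤ 0 Bernoulli's inequality does,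
reversed by the factor u. -/
lemma one_add_rpow_le {u s : ℝ} (hs : 2 ≤ s) (hu : |u| ≤ 1 / 2) :
    (1 + u) ^ s ≤ 1 + s * u + s * ((s - 1) * 2 ^ s) * u ^ 2 := by
  obtain ⟨hu1, hu2⟩ := abs_le.1 hu
  have hv : 0 < 1 + u := by linarith
  have h1 := rpow_le_one_add_mul_sub_one_mul hv (p := s) (by linarith)
  suffices hkey : u * ((1 + u) ^ (s - 1) - 1) ≤ (s - 1) * 2 ^ s * u ^ 2 by
    have := mul_le_mul_of_nonneg_left hkey (by linarith : (0 : ℝ) ≤ s)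
    nlinarith
  have h2s : (1 : ℝ) ≤ 2 ^ s := Real.one_le_rpow (by norm_num) (by linarith)
  rcases le_total 0 u with h0 | h0
  · have h2 := rpow_le_one_add_mul_sub_one_mul hv (p := s - 1) (by linarith)
    have h3 : (1 + u) ^ (s - 1 - 1) ≤ 2 ^ s :=
      (Real.rpow_le_rpow hv.le (by linarith) (by linarith)).trans
        (Real.rpow_le_rpow_of_exponent_le (by norm_num) (by linarith))
    have h4 := mul_le_mul_of_nonneg_left h3 (mul_nonneg (by linarith : 0 ≤ s - 1) h0)
    have h5 : (1 + u) ^ (s - 1) - 1 ≤ (s - 1) * u * 2 ^ s := by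
      rw [add_sub_cancel_left] at h2; linarith
    nlinarith [mul_le_mul_of_nonneg_left h5 h0]
  · have h2 := one_add_mul_self_le_rpow_one_add (s := u) (by linarith) (p := s - 1) (by linarith)
    have h3 : (s - 1) * u ^ 2 ≤ (s - 1) * u ^ 2 * 2 ^ s :=
      le_mul_of_one_le_right (mul_nonneg (by linarith) (sq_nonneg u)) h2s
    nlinarith [mul_nonneg_of_nonpos_of_nonpos h0 (by linarith : (s - 1) * u - ((1 + u) ^ (s - 1) - 1) ≤ 0)]

lemma abs_rpow_eq_abs_rpow_sub_two_mul_sq (a : ℝ) {s : ℝ} (hs : 2 < s) :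
    |a| ^ s = |a| ^ (s - 2) * a ^ 2 := by
  rw [← sq_abs a, ← Real.rpow_natCast |a| 2, ← Real.rpow_add' (abs_nonneg a)]
  · congr 1; push_cast; ring
  · push_cast; linarith

/-- Second order expansion of `|a + b| ^ s`. -/
lemma abs_add_rpow_le {s : ℝ} (hs : 2 < s) : ∃ C : ℝ, 0 ≤ C ∧ ∀ a b : ℝ,
    |a + b| ^ s ≤ |a| ^ s + s * (|a| ^ (s - 2) * a) * b
      + C * (|a| ^ (s - 2) * b ^ 2 + |b| ^ s) := by
  set C₁ : ℝ := s * ((s - 1) * 2 ^ s)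
  set C₂ : ℝ := 3 ^ s + s * 2 ^ s
  have hC₁ : 0 ≤ C₁ := mul_nonneg (by linarith) (mul_nonneg (by linarith) (by positivity))
  have hC₂ : 0 ≤ C₂ := add_nonneg (by positivity) (mul_nonneg (by linarith) (by positivity))
  refine ⟨C₁ + C₂, by positivity, fun a b => ?_⟩
  have hA : 0 ≤ |a| ^ (s - 2) := by positivity
  have hB : 0 ≤ |b| ^ s := by positivity
  have hAB : 0 ≤ |a| ^ (s - 2) * b ^ 2 := by positivity
  -- For small b/a, the second order bound for (1 + b/a)^s applies, with constant C₁. Otherwise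
  -- |b|^s dominates everything: 3^s bounds |a + b|^s and s 2^s compensates a negative linear term,
  -- whence C₂.
  rcases le_or_gt |b| (|a| / 2) with hba | hba
  · rcases eq_or_ne a 0 with rfl | ha
    · have : b = 0 := by simpa using hba
      subst this
      have : s ≠ 0 := by linarith
      simp [Real.zero_rpow this]
    have hapos : 0 < |a| := abs_pos.2 ha
    have hu : |b / a| ≤ 1 / 2 := by rw [abs_div, div_le_iff₀ hapos]; linarith
    have h1 := one_add_rpow_le hs.le hu
    have hnn : 0 ≤ 1 + b / a := by linarith [(abs_le.1 hu).1]
    have h2 : |a + b| = |a| * (1 + b / a) := by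
      rw [← abs_of_nonneg hnn, ← abs_mul]; congr 1; field_simp
    have h3 : |a| ^ s * (b / a) = |a| ^ (s - 2) * a * b := by
      rw [abs_rpow_eq_abs_rpow_sub_two_mul_sq a hs]; field_simp
    have h4 : |a| ^ s * (b / a) ^ 2 = |a| ^ (s - 2) * b ^ 2 := by
      rw [abs_rpow_eq_abs_rpow_sub_two_mul_sq a hs]; field_simp
    rw [h2, Real.mul_rpow hapos.le hnn]
    calc |a| ^ s * (1 + b / a) ^ s ≤ |a| ^ s * (1 + s * (b / a) + C₁ * (b / a) ^ 2) :=
          mul_le_mul_of_nonneg_left h1 (by positivity)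
      _ = |a| ^ s + s * (|a| ^ (s - 2) * a) * b + C₁ * (|a| ^ (s - 2) * b ^ 2) := by
          rw [← h4]; linear_combination s * h3
      _ ≤ _ := by nlinarith [mul_nonneg hC₁ hB, mul_nonneg hC₂ hAB, mul_nonneg hC₂ hB]
  · have h1 : |a + b| ^ s ≤ 3 ^ s * |b| ^ s := by
      rw [← Real.mul_rpow (by norm_num) (abs_nonneg b)]
      exact Real.rpow_le_rpow (abs_nonneg _) (by linarith [abs_add_le a b]) (by linarith)
    have h2 : |a| ^ (s - 2) * |a| * |b| ≤ 2 ^ s * |b| ^ s := by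
      have h3 : |a| ^ (s - 2) ≤ 2 ^ (s - 2) * |b| ^ (s - 2) := by
        rw [← Real.mul_rpow (by norm_num) (abs_nonneg b)]
        exact Real.rpow_le_rpow (abs_nonneg _) (by linarith) (by linarith)
      have h4 : (2 : ℝ) ^ s = 2 ^ (s - 2) * 2 ^ 2 := by
        simpa using abs_rpow_eq_abs_rpow_sub_two_mul_sq 2 hs
      have h4' : (0 : ℝ) < 2 ^ (s - 2) := by positivity
      rw [h4, abs_rpow_eq_abs_rpow_sub_two_mul_sq b hs]
      calc |a| ^ (s - 2) * |a| * |b|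
          ≤ (2 ^ (s - 2) * |b| ^ (s - 2)) * (2 * |b|) * |b| := by gcongr; linarith
        _ ≤ 2 ^ (s - 2) * 2 ^ 2 * (|b| ^ (s - 2) * b ^ 2) := by
          rw [← sq_abs b]
          have : 0 ≤ 2 ^ (s - 2) * |b| ^ (s - 2) * |b| ^ 2 := by positivity
          nlinarith
    have h5 : -(2 ^ s * |b| ^ s) ≤ |a| ^ (s - 2) * a * b := by
      have : |(|a| ^ (s - 2) * a * b)| = |a| ^ (s - 2) * |a| * |b| := by
        rw [abs_mul, abs_mul, abs_of_nonneg hA]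
      linarith [neg_abs_le (|a| ^ (s - 2) * a * b)]
    have h6 : 0 ≤ |a| ^ s := by positivity
    have h7 := mul_le_mul_of_nonneg_left h5 (by linarith : 0 ≤ s)
    have h8 : C₂ * |b| ^ s = 3 ^ s * |b| ^ s + s * (2 ^ s * |b| ^ s) := by ring
    nlinarith [mul_nonneg hC₁ hB, mul_nonneg hC₂ hAB, mul_nonneg hC₁ hAB]

lemma rpow_le_one_add_rpow {t p q : ℝ} (ht : 0 ≤ t) (hp : 0 ≤ p) (hpq : p ≤ q) :
    t ^ p ≤ 1 + t ^ q := by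
  rcases le_total t 1 with h | h
  · linarith [Real.rpow_le_one ht h hp, Real.rpow_nonneg ht q]
  · linarith [Real.rpow_le_rpow_of_exponent_le h hpq]

/-- The two terms cover t² ≥ q and t² ≤ q. The free parameter q is later taken proportional to n, so
that the moment of order s appears with a small factor over n. -/
lemma rpow_sub_two_le_div_add {t q s : ℝ} (ht : 0 ≤ t) (hq : 0 < q) (hs : 2 < s) :
    t ^ (s - 2) ≤ t ^ s / q + q ^ (s / 2 - 1) := by
  have h1 : 0 ≤ t ^ (s - 2) := Real.rpow_nonneg ht _
  rcases le_total (t ^ 2) q with h | h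
  · have h2 : t ^ (s - 2) = (t ^ 2) ^ (s / 2 - 1) := by
      rw [← Real.rpow_natCast, ← Real.rpow_mul ht]; congr 1; push_cast; ring
    have h3 := Real.rpow_le_rpow (sq_nonneg t) h (by linarith : 0 ≤ s / 2 - 1)
    have h4 : 0 ≤ t ^ s / q := by positivity
    linarith
  · have h2 := abs_rpow_eq_abs_rpow_sub_two_mul_sq t hs
    rw [abs_of_nonneg ht] at h2
    have h3 : t ^ (s - 2) ≤ t ^ s / q := by
      rw [le_div_iff₀ hq, h2]; exact mul_le_mul_of_nonneg_left h h1
    have h4 : 0 ≤ q ^ (s / 2 - 1) := by positivity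
    linarith

/-- Bernoulli's inequality at 1/x; this lower bound for the increment of x ^ p closes the induction
in `le_mul_rpow_of_recursion`. -/
lemma rpow_add_mul_rpow_sub_one_le {x p : ℝ} (hx : 0 < x) (hp : 1 ≤ p) :
    x ^ p + p * x ^ (p - 1) ≤ (x + 1) ^ p := by
  have h1 := one_add_mul_self_le_rpow_one_add (s := x⁻¹) (by linarith [inv_pos.2 hx]) hp
  have h2 := mul_le_mul_of_nonneg_left h1 (Real.rpow_nonneg hx.le p)
  rw [← Real.mul_rpow hx.le (by positivity), mul_add, mul_add, mul_inv_cancel₀ hx.ne'] at h2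
  have h3 : x ^ (p - 1) = x ^ p * x⁻¹ := by
    rw [Real.rpow_sub_one hx.ne', div_eq_mul_inv]
  rw [h3]
  simp only [mul_one] at h2
  linarith

/-- The recursion behind the moment inequality: increments of order
`a / n` with a small constant and of order `n ^ (p - 1)` keep `a n` of order `n ^ p`. -/
lemma le_mul_rpow_of_recursion {a : ℕ → ℝ} {B D p : ℝ} (hp : 1 ≤ p) (hB : 0 ≤ B)
    (h0 : a 0 ≤ 0) (h1 : a 1 ≤ B) (hD : D ≤ p / 2 * B)
    (hstep : ∀ n : ℕ, 1 ≤ n → a (n + 1) ≤ a n + p / 2 * (a n / n) + D * (n : ℝ) ^ (p - 1))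
    (n : ℕ) : a n ≤ B * (n : ℝ) ^ p := by
  induction n with
  | zero => exact h0.trans (by positivity)
  | succ n ih =>
    rcases Nat.eq_zero_or_pos n with rfl | hn
    · simpa using h1
    have hn' : (0 : ℝ) < n := by exact_mod_cast hn
    have h2 := rpow_add_mul_rpow_sub_one_le hn' hp
    have h3 : (n : ℝ) ^ p = (n : ℝ) ^ (p - 1) * n := by
      rw [← Real.rpow_add_one hn'.ne']; congr 1; ring
    have h4 : a n / n ≤ B * (n : ℝ) ^ (p - 1) := by
      rw [div_le_iff₀ hn', mul_assoc, ← h3]; exact ih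
    have h5 : 0 ≤ (n : ℝ) ^ (p - 1) := by positivity
    push_cast
    calc a (n + 1) ≤ a n + p / 2 * (a n / n) + D * (n : ℝ) ^ (p - 1) := hstep n hn
      _ ≤ B * (n : ℝ) ^ p + p / 2 * (B * (n : ℝ) ^ (p - 1))
          + p / 2 * B * (n : ℝ) ^ (p - 1) := by gcongr
      _ = B * ((n : ℝ) ^ p + p * (n : ℝ) ^ (p - 1)) := by ring
      _ ≤ B * ((n : ℝ) + 1) ^ p := by gcongr

section Moments

variable {Ω : Type*} [MeasurableSpace Ω] {P : Measure Ω} [IsProbabilityMeasure P]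

lemma integrable_abs_rpow_of_le {Z : Ω → ℝ} (hZ : Measurable Z) {p q : ℝ} (hp : 0 ≤ p)
    (hpq : p ≤ q) (hint : Integrable (fun ω => |Z ω| ^ q) P) :
    Integrable (fun ω => |Z ω| ^ p) P := by
  refine ((integrable_const (1 : ℝ)).add hint).mono' (by fun_prop) (.of_forall fun ω => ?_)
  rw [Real.norm_of_nonneg (by positivity)]
  exact rpow_le_one_add_rpow (abs_nonneg _) hp hpq

lemma integrable_of_integrable_abs_rpow {Z : Ω → ℝ} (hZ : Measurable Z) {q : ℝ} (hq : 1 ≤ q)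
    (hint : Integrable (fun ω => |Z ω| ^ q) P) : Integrable Z P := by
  have h := integrable_abs_rpow_of_le hZ zero_le_one hq hint
  simp only [Real.rpow_one] at h
  exact (integrable_norm_iff hZ.aestronglyMeasurable).1 h

lemma abs_add_rpow_le_two_rpow_mul {s : ℝ} (hs : 0 ≤ s) (a b : ℝ) :
    |a + b| ^ s ≤ 2 ^ s * (|a| ^ s + |b| ^ s) := by
  have h1 : |a + b| ≤ 2 * max |a| |b| := by
    linarith [abs_add_le a b, le_max_left |a| |b|, le_max_right |a| |b|]
  have hm : 0 ≤ max |a| |b| := (abs_nonneg a).trans (le_max_left _ _)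
  have ha : 0 ≤ |a| ^ s := by positivity
  have hb : 0 ≤ |b| ^ s := by positivity
  refine (Real.rpow_le_rpow (abs_nonneg _) h1 hs).trans ?_
  rw [Real.mul_rpow (by norm_num) hm]
  gcongr
  rcases max_choice |a| |b| with h | h <;> rw [h] <;> linarith

omit [IsProbabilityMeasure P] in
lemma integrable_abs_add_rpow {Z W : Ω → ℝ} (hZ : Measurable Z) (hW : Measurable W) {s : ℝ}
    (hs : 0 ≤ s) (hZi : Integrable (fun ω => |Z ω| ^ s) P)
    (hWi : Integrable (fun ω => |W ω| ^ s) P) : Integrable (fun ω => |Z ω + W ω| ^ s) P := by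
  refine ((hZi.add hWi).const_mul (2 ^ s)).mono' (by fun_prop) (.of_forall fun ω => ?_)
  rw [Real.norm_of_nonneg (by positivity)]
  exact abs_add_rpow_le_two_rpow_mul hs _ _

lemma integrable_abs_sum_rpow {Y : ℕ → Ω → ℝ} (hY : ∀ i, Measurable (Y i)) {s : ℝ} (hs : 0 < s)
    (hint : ∀ i, Integrable (fun ω => |Y i ω| ^ s) P) (n : ℕ) :
    Integrable (fun ω => |∑ i ∈ Finset.range n, Y i ω| ^ s) P := by
  induction n with
  | zero => simp [Real.zero_rpow hs.ne']
  | succ n ih =>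
    simp only [Finset.sum_range_succ]
    exact integrable_abs_add_rpow (by fun_prop) (hY n) hs.le ih (hint n)

/-- Growth of the absolute moment of order `s` when an independent centered variable is added. -/
lemma exists_integral_abs_add_rpow_le {s : ℝ} (hs : 2 < s) : ∃ C : ℝ, 0 ≤ C ∧
    ∀ Z W : Ω → ℝ, Measurable Z → Measurable W → IndepFun Z W P →
      Integrable (fun ω => |Z ω| ^ s) P → Integrable (fun ω => |W ω| ^ s) P →
      ∫ ω, W ω ∂P = 0 → ∀ K : ℝ, ∫ ω, |W ω| ^ s ∂P ≤ K → ∀ q : ℝ, 0 < q →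
      ∫ ω, |Z ω + W ω| ^ s ∂P ≤ ∫ ω, |Z ω| ^ s ∂P
        + C * (((∫ ω, |Z ω| ^ s ∂P) / q + q ^ (s / 2 - 1)) * (1 + K) + K) := by
  obtain ⟨C, hC, hpt⟩ := abs_add_rpow_le hs
  refine ⟨C, hC, fun Z W hZ hW hind hZi hWi hW0 K hK q hq => ?_⟩
  have hZ2 := integrable_abs_rpow_of_le hZ (by linarith : 0 ≤ s - 2) (by linarith) hZi
  have hZ1 : Integrable (fun ω => |Z ω| ^ (s - 2) * Z ω) P := by
    refine (integrable_abs_rpow_of_le hZ (by linarith : 0 ≤ s - 1) (by linarith) hZi).mono'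
      (by fun_prop) (.of_forall fun ω => ?_)
    rw [Real.norm_eq_abs, abs_mul, abs_of_nonneg (by positivity : 0 ≤ |Z ω| ^ (s - 2)),
      ← Real.rpow_add_one' (abs_nonneg _) (by linarith)]
    exact le_of_eq (by congr 1; ring)
  have hW1 := integrable_of_integrable_abs_rpow hW (by linarith) hWi
  have hsq : ∀ ω, |W ω| ^ (2 : ℝ) = W ω ^ 2 := fun ω => by
    rw [Real.rpow_two, sq_abs]
  have hW2 : Integrable (fun ω => W ω ^ 2) P := by
    simpa only [hsq] using integrable_abs_rpow_of_le hW zero_le_two hs.le hWi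
  have hW2le : ∫ ω, W ω ^ 2 ∂P ≤ 1 + K := by
    calc ∫ ω, W ω ^ 2 ∂P ≤ ∫ ω, (1 + |W ω| ^ s) ∂P :=
          integral_mono hW2 ((integrable_const _).add hWi) fun ω => by
            simpa only [hsq] using rpow_le_one_add_rpow (abs_nonneg (W ω)) zero_le_two hs.le
      _ ≤ 1 + K := by rw [integral_add (integrable_const _) hWi]; simpa using hK
  have hZ2le : ∫ ω, |Z ω| ^ (s - 2) ∂P ≤ (∫ ω, |Z ω| ^ s ∂P) / q + q ^ (s / 2 - 1) := by
    calc ∫ ω, |Z ω| ^ (s - 2) ∂P ≤ ∫ ω, (|Z ω| ^ s / q + q ^ (s / 2 - 1)) ∂P :=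
          integral_mono hZ2 ((hZi.div_const _).add (integrable_const _)) fun ω =>
            rpow_sub_two_le_div_add (abs_nonneg _) hq hs
      _ = _ := by
          rw [integral_add (hZi.div_const _) (integrable_const _), integral_div]; simp
  have hind1 : IndepFun (fun ω => |Z ω| ^ (s - 2) * Z ω) W P :=
    hind.comp (φ := fun z => |z| ^ (s - 2) * z) (ψ := id) (by fun_prop) measurable_id
  have hind2 : IndepFun (fun ω => |Z ω| ^ (s - 2)) (fun ω => W ω ^ 2) P :=
    hind.comp (φ := fun z => |z| ^ (s - 2)) (ψ := fun w => w ^ 2) (by fun_prop) (by fun_prop)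
  have hi1 : Integrable (fun ω => |Z ω| ^ (s - 2) * Z ω * W ω) P := hind1.integrable_mul hZ1 hW1
  have hi2 : Integrable (fun ω => |Z ω| ^ (s - 2) * W ω ^ 2) P := hind2.integrable_mul hZ2 hW2
  -- Independence and centering remove the first order term, leaving the increment of second order.
  have he1 : ∫ ω, |Z ω| ^ (s - 2) * Z ω * W ω ∂P = 0 := by
    rw [hind1.integral_fun_mul_eq_mul_integral hZ1.aestronglyMeasurable hW1.aestronglyMeasurable, hW0, mul_zero]
  have he2 : ∫ ω, |Z ω| ^ (s - 2) * W ω ^ 2 ∂P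
      = (∫ ω, |Z ω| ^ (s - 2) ∂P) * ∫ ω, W ω ^ 2 ∂P :=
    hind2.integral_fun_mul_eq_mul_integral hZ2.aestronglyMeasurable hW2.aestronglyMeasurable
  have hi3 : Integrable (fun ω => |Z ω| ^ s + s * (|Z ω| ^ (s - 2) * Z ω * W ω)) P :=
    hZi.add (hi1.const_mul s)
  have hi4 : Integrable (fun ω => C * (|Z ω| ^ (s - 2) * W ω ^ 2 + |W ω| ^ s)) P :=
    (hi2.add hWi).const_mul C
  have hZ2nn : 0 ≤ ∫ ω, |Z ω| ^ (s - 2) ∂P := integral_nonneg fun ω => by positivity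
  have hW2nn : 0 ≤ ∫ ω, W ω ^ 2 ∂P := integral_nonneg fun ω => by positivity
  have hprod := mul_le_mul hZ2le hW2le hW2nn (hZ2nn.trans hZ2le)
  calc ∫ ω, |Z ω + W ω| ^ s ∂P
      ≤ ∫ ω, ((|Z ω| ^ s + s * (|Z ω| ^ (s - 2) * Z ω * W ω))
          + C * (|Z ω| ^ (s - 2) * W ω ^ 2 + |W ω| ^ s)) ∂P := by
        refine integral_mono (integrable_abs_add_rpow hZ hW (by linarith) hZi hWi)
          (hi3.add hi4) fun ω => ?_
        have := hpt (Z ω) (W ω)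
        simp only
        linarith
    _ = ∫ ω, |Z ω| ^ s ∂P + C * ((∫ ω, |Z ω| ^ (s - 2) ∂P) * (∫ ω, W ω ^ 2 ∂P)
          + ∫ ω, |W ω| ^ s ∂P) := by
        rw [integral_add hi3 hi4,
          integral_add hZi (hi1.const_mul s), integral_const_mul, integral_const_mul,
          integral_add hi2 hWi, he1, he2]
        ring
    _ ≤ _ := by gcongr

/-- **Marcinkiewicz–Zygmund type inequality**: sums of `n` independent centered random variables
with uniformly bounded absolute moments of order `s > 2` have absolute moment of order `s`
at most a constant times `n ^ (s / 2)`. -/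
theorem exists_integral_abs_sum_rpow_le (P : Measure Ω) [IsProbabilityMeasure P] {s : ℝ}
    (hs : 2 < s) {K : ℝ} (hK0 : 0 ≤ K) : ∃ B : ℝ, 0 ≤ B ∧ ∀ Y : ℕ → Ω → ℝ, (∀ i, Measurable (Y i)) →
      iIndepFun Y P → (∀ i, Integrable (fun ω => |Y i ω| ^ s) P) → (∀ i, ∫ ω, Y i ω ∂P = 0) →
      (∀ i, ∫ ω, |Y i ω| ^ s ∂P ≤ K) →
      ∀ n : ℕ, ∫ ω, |∑ i ∈ Finset.range n, Y i ω| ^ s ∂P ≤ B * (n : ℝ) ^ (s / 2) := by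
  obtain ⟨C, hC, hstep⟩ := exists_integral_abs_add_rpow_le (P := P) hs
  set v : ℝ := 1 + K
  have hv : 0 < v := by positivity
  -- With q = n/η, the coefficient of A/n in the recursion is C v η. This η makes it at most s/4,
  -- that is p/2 for p = s/2.
  set η : ℝ := s / (4 * (C * v + 1))
  have hη : 0 < η := div_pos (by linarith) (by positivity)
  have hCη : C * v * η ≤ s / 2 / 2 := by
    have : C * v * η = s / 4 * (C * v / (C * v + 1)) := by
      simp only [η]; field_simp
    rw [this]
    have h1 : C * v / (C * v + 1) ≤ 1 := (div_le_one (by positivity)).2 (by linarith)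
    nlinarith
  set D : ℝ := C * v * (η⁻¹) ^ (s / 2 - 1) + C * K
  have hD : 0 ≤ D := by positivity
  have hs4 : 0 ≤ 4 / s := div_nonneg (by norm_num) (by linarith)
  -- The summand K covers n = 1, and 4D/s ensures D ≤ (s/4)B.
  refine ⟨K + 4 / s * D, by positivity, fun Y hY hind hint h0 hKb => ?_⟩
  refine le_mul_rpow_of_recursion (D := D) (by linarith) (by positivity) ?_ ?_ ?_ ?_
  · simp [Real.zero_rpow (by linarith : s ≠ 0)]
  · simpa using (hKb 0).trans (le_add_of_nonneg_right (by positivity))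
  · have : s / 2 / 2 * (4 / s * D) = D := by field_simp; norm_num
    rw [mul_add, this]
    have : 0 ≤ s / 2 / 2 * K := mul_nonneg (by linarith) hK0
    linarith
  · intro n hn
    have hn1 : (1 : ℝ) ≤ n := by exact_mod_cast hn
    have hn' : (0 : ℝ) < n := by linarith
    have hi : IndepFun (fun ω => ∑ i ∈ Finset.range n, Y i ω) (Y n) P := by
      have := hind.indepFun_finsetSum_of_notMem hY (s := Finset.range n) (i := n) (by simp)
      convert this using 1
      ext ω; simp
    have h1 := hstep _ (Y n) (by fun_prop) (hY n) hi
      (integrable_abs_sum_rpow hY (by linarith) hint n) (hint n) (h0 n) K (hKb n) (n * η⁻¹)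
      (by positivity)
    simp only [Finset.sum_range_succ]
    set A : ℝ := ∫ ω, |∑ i ∈ Finset.range n, Y i ω| ^ s ∂P
    have hA : 0 ≤ A := integral_nonneg fun ω => by positivity
    refine h1.trans ?_
    rw [Real.mul_rpow hn'.le (by positivity)]
    have h2 : A / (n * η⁻¹) = A / n * η := by field_simp
    have h3 : C * v * η * (A / n) ≤ s / 2 / 2 * (A / n) := by gcongr
    have h4 : C * K ≤ C * K * (n : ℝ) ^ (s / 2 - 1) :=
      le_mul_of_one_le_right (by positivity) (Real.one_le_rpow hn1 (by linarith))
    rw [h2]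
    calc A + C * ((A / n * η + (n : ℝ) ^ (s / 2 - 1) * η⁻¹ ^ (s / 2 - 1)) * v + K)
        = A + C * v * η * (A / n) + C * v * η⁻¹ ^ (s / 2 - 1) * (n : ℝ) ^ (s / 2 - 1) + C * K := by
          ring
      _ ≤ A + s / 2 / 2 * (A / n) + C * v * η⁻¹ ^ (s / 2 - 1) * (n : ℝ) ^ (s / 2 - 1)
          + C * K * (n : ℝ) ^ (s / 2 - 1) := by gcongr
      _ = _ := by simp only [D]; ring

/-! ### Maximal inequalities -/

/-- Doob's maximal inequality of order `s` for partial sums. -/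
theorem measure_exists_le_abs_sum_le {s : ℝ} (hs : 1 ≤ s) {Y : ℕ → Ω → ℝ}
    (hY : ∀ i, Measurable (Y i)) (hind : iIndepFun Y P)
    (hint : ∀ i, Integrable (fun ω => |Y i ω| ^ s) P) (h0 : ∀ i, ∫ ω, Y i ω ∂P = 0)
    {lam : ℝ} (hlam : 0 < lam) (N : ℕ) :
    P {ω | ∃ k, 1 ≤ k ∧ k ≤ N ∧ lam ≤ |∑ i ∈ Finset.range k, Y i ω|}
      ≤ ENNReal.ofReal ((∫ ω, |∑ i ∈ Finset.range N, Y i ω| ^ s ∂P) / lam ^ s) := by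
  rcases N with _ | N
  · have : {ω | ∃ k, 1 ≤ k ∧ k ≤ 0 ∧ lam ≤ |∑ i ∈ Finset.range k, Y i ω|} = ∅ := by
      ext ω; simp
    rw [this]; simp
  have hYs : ∀ i, StronglyMeasurable (Y i) := fun i => (hY i).stronglyMeasurable
  set 𝒢 := Filtration.natural Y hYs
  -- T n has n + 1 terms, so that it is measurable for 𝒢 n, generated by Y 0, …, Y n. The sums of
  -- lengths 1, …, N + 1 are T 0, …, T N.
  set T : ℕ → Ω → ℝ := fun n ω => ∑ i ∈ Finset.range (n + 1), Y i ω with hT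
  have hTs : ∀ n, StronglyMeasurable[𝒢 n] (T n) := fun n =>
    Finset.stronglyMeasurable_fun_sum _ fun i hi =>
      ((Filtration.stronglyAdapted_natural hYs) i).mono
        (𝒢.mono (Nat.lt_succ_iff.1 (Finset.mem_range.1 hi)))
  have hTi : ∀ n, Integrable (T n) P := fun n => integrable_finsetSum _ fun i _ =>
    integrable_of_integrable_abs_rpow (hY i) hs (hint i)
  have hTsi : ∀ n, Integrable (fun ω => |T n ω| ^ s) P := fun n =>
    integrable_abs_sum_rpow hY (by linarith) hint (n + 1)
  have hsub : Submartingale (fun n ω => |T n ω| ^ s) 𝒢 P := by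
    refine submartingale_nat (fun n => ?_) hTsi fun n => ?_
    · exact ((Real.continuous_rpow_const (by linarith)).comp continuous_abs).comp_stronglyMeasurable
        (hTs n)
    · have hce : P[T (n + 1)|𝒢 n] =ᵐ[P] T n := by
        have hsum : T (n + 1) = T n + Y (n + 1) := by
          ext ω; simp [hT, Finset.sum_range_succ _ (n + 1)]
        rw [hsum]
        filter_upwards [condExp_add (hTi n)
          (integrable_of_integrable_abs_rpow (hY (n + 1)) hs (hint (n + 1))) (𝒢 n),
          hind.condExp_natural_ae_eq_of_lt hYs (Nat.lt_succ_self n)] with ω h1 h2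
        rw [h1, Pi.add_apply, h2, h0,
          condExp_of_stronglyMeasurable (𝒢.le n) (hTs n) (hTi n), add_zero]
      -- Conditional Jensen: the s-th power of the absolute value of a martingale is a
      -- submartingale.
      have hJ := Integrable.norm_condExp_rpow_le (m := 𝒢 n) (f := T (n + 1)) (μ := P) hs
        (by simpa only [Real.norm_eq_abs] using hTsi (n + 1))
      filter_upwards [hce, hJ] with ω h1 h2
      rw [h1] at h2
      exact h2
  have hlams : 0 < lam ^ s := Real.rpow_pos_of_pos hlam s
  have hmax := maximal_ineq hsub (fun n ω => Real.rpow_nonneg (abs_nonneg _) s)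
    (ε := (lam ^ s).toNNReal) N
  rw [Real.coe_toNNReal _ hlams.le] at hmax
  set E := {ω | lam ^ s ≤ (Finset.range (N + 1)).sup' Finset.nonempty_range_add_one
    fun k => |T k ω| ^ s}
  have hE : {ω | ∃ k, 1 ≤ k ∧ k ≤ N + 1 ∧ lam ≤ |∑ i ∈ Finset.range k, Y i ω|} ⊆ E := by
    rintro ω ⟨k, hk1, hkN, hk⟩
    obtain ⟨j, rfl⟩ : ∃ j, k = j + 1 := ⟨k - 1, by omega⟩
    exact (Real.rpow_le_rpow hlam.le hk (by linarith)).trans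
      (Finset.le_sup' (fun k => |T k ω| ^ s) (Finset.mem_range.2 (by omega : j < N + 1)))
  refine (measure_mono hE).trans ?_
  rw [ENNReal.ofReal_div_of_pos hlams, ENNReal.le_div_iff_mul_le (by simp [hlams]) (by simp),
    mul_comm]
  refine hmax.trans (ENNReal.ofReal_le_ofReal ?_)
  exact setIntegral_le_integral (hTsi N) (.of_forall fun ω => Real.rpow_nonneg (abs_nonneg _) s)

lemma exists_dyadic_block {n k : ℕ} (hn : 1 ≤ n) (hnk : n ≤ k) :
    ∃ j : ℕ, 2 ^ j * n ≤ k ∧ k ≤ 2 ^ (j + 1) * n := by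
  refine ⟨Nat.log 2 (k / n), ?_, ?_⟩
  · rw [← Nat.le_div_iff_mul_le hn]
    exact Nat.pow_log_le_self 2 (Nat.div_pos hnk hn).ne'
  · exact ((Nat.div_lt_iff_lt_mul hn).1 (Nat.lt_pow_succ_log_self one_lt_two (k / n))).le

/-- Tail bound for the suprema of the averages in the strong law of large numbers. -/
theorem measure_exists_mul_le_abs_sum_le {s : ℝ} (hs : 2 ≤ s) {Y : ℕ → Ω → ℝ}
    (hY : ∀ i, Measurable (Y i)) (hind : iIndepFun Y P)
    (hint : ∀ i, Integrable (fun ω => |Y i ω| ^ s) P) (h0 : ∀ i, ∫ ω, Y i ω ∂P = 0)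
    {B : ℝ} (hB0 : 0 ≤ B)
    (hB : ∀ n : ℕ, ∫ ω, |∑ i ∈ Finset.range n, Y i ω| ^ s ∂P ≤ B * (n : ℝ) ^ (s / 2))
    {lam : ℝ} (hlam : 0 < lam) {n : ℕ} (hn : 1 ≤ n) :
    P {ω | ∃ k, n ≤ k ∧ lam * k ≤ |∑ i ∈ Finset.range k, Y i ω|}
      ≤ ENNReal.ofReal (2 * (B * 2 ^ (s / 2)) * lam ^ (-s) * (n : ℝ) ^ (-(s / 2))) := by
  have hn' : (0 : ℝ) < n := by exact_mod_cast hn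
  set D : ℝ := B * 2 ^ (s / 2) * lam ^ (-s) * (n : ℝ) ^ (-(s / 2))
  have hD : 0 ≤ D := by positivity
  -- On the j-th block, k is at least 2^j n, so the moving threshold lam k may be lowered to a fixed
  -- one; Doob's inequality is then used up to the right end 2^(j+1) n.
  have hblock : ∀ j : ℕ, P {ω | ∃ k, 1 ≤ k ∧ k ≤ 2 ^ (j + 1) * n ∧
      lam * (2 ^ j * n) ≤ |∑ i ∈ Finset.range k, Y i ω|} ≤ ENNReal.ofReal (D * (1 / 2) ^ j) := by
    intro j
    have hx : (0 : ℝ) < 2 ^ j * n := by positivity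
    refine (measure_exists_le_abs_sum_le (by linarith) hY hind hint h0
      (mul_pos hlam hx) _).trans (ENNReal.ofReal_le_ofReal ?_)
    have h1 := hB (2 ^ (j + 1) * n)
    have h2 : (((2 ^ (j + 1) * n : ℕ) : ℝ)) = 2 * (2 ^ j * n) := by push_cast; ring
    rw [h2, Real.mul_rpow zero_le_two hx.le] at h1
    have h3 : (2 ^ j * (n : ℝ)) ^ (s / 2) / (2 ^ j * (n : ℝ)) ^ s
        = (2 ^ j : ℝ) ^ (-(s / 2)) * (n : ℝ) ^ (-(s / 2)) := by
      rw [← Real.rpow_sub hx, ← Real.mul_rpow (by positivity) hn'.le]; congr 1; ring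
    -- Since s ≥ 2, the block bounds decay at least like 2^(-j).
    have h4 : (2 ^ j : ℝ) ^ (-(s / 2)) ≤ (1 / 2) ^ j := by
      calc (2 ^ j : ℝ) ^ (-(s / 2)) ≤ (2 ^ j : ℝ) ^ (-1 : ℝ) :=
            Real.rpow_le_rpow_of_exponent_le (one_le_pow₀ one_le_two) (by linarith)
        _ = (1 / 2) ^ j := by rw [Real.rpow_neg_one]; simp
    rw [Real.mul_rpow hlam.le hx.le]
    calc _ ≤ B * (2 ^ (s / 2) * (2 ^ j * (n : ℝ)) ^ (s / 2))
          / (lam ^ s * (2 ^ j * (n : ℝ)) ^ s) := by gcongr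
      _ = B * 2 ^ (s / 2) * lam ^ (-s)
          * ((2 ^ j * (n : ℝ)) ^ (s / 2) / (2 ^ j * (n : ℝ)) ^ s) := by
          rw [Real.rpow_neg hlam.le]; field_simp
      _ = D * (2 ^ j : ℝ) ^ (-(s / 2)) := by rw [h3]; ring
      _ ≤ D * (1 / 2) ^ j := by gcongr
  have hsub : {ω | ∃ k, n ≤ k ∧ lam * k ≤ |∑ i ∈ Finset.range k, Y i ω|} ⊆
      ⋃ j : ℕ, {ω | ∃ k, 1 ≤ k ∧ k ≤ 2 ^ (j + 1) * n ∧
        lam * (2 ^ j * n) ≤ |∑ i ∈ Finset.range k, Y i ω|} := by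
    rintro ω ⟨k, hnk, hk⟩
    obtain ⟨j, hj1, hj2⟩ := exists_dyadic_block hn hnk
    refine mem_iUnion.2 ⟨j, k, hn.trans hnk, hj2, le_trans ?_ hk⟩
    have : (2 ^ j * n : ℝ) ≤ k := by exact_mod_cast hj1
    gcongr
  calc _ ≤ ∑' j : ℕ, ENNReal.ofReal (D * (1 / 2) ^ j) :=
        (measure_mono hsub).trans ((measure_iUnion_le _).trans (ENNReal.tsum_le_tsum hblock))
    _ = ENNReal.ofReal (D * 2) := by
        rw [← ENNReal.ofReal_tsum_of_nonneg (fun j => by positivity)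
          (summable_geometric_two.mul_left D), tsum_mul_left, tsum_geometric_two]
    _ = _ := by congr 1; simp only [D]; ring

end Moments

/-! ### Deviations of the smallest minimizing points -/

section Deviation

variable {S Ω : Type*} [MeasurableSpace S] [MeasurableSpace Ω] {Q : Measure S}
  [IsProbabilityMeasure Q] {P : Measure Ω} [IsProbabilityMeasure P]

/-- The mean is at most 1 + K in absolute value because t ≤ 1 + t^s. The bound depends only on K and
s, which keeps the constants after centering uniform in φ. -/
lemma integral_abs_sub_integral_rpow_le {φ : S → ℝ} (hφ : Measurable φ) {s : ℝ} (hs : 1 ≤ s)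
    (hint : Integrable (fun x => |φ x| ^ s) Q) {K : ℝ} (hK : ∫ x, |φ x| ^ s ∂Q ≤ K) :
    ∫ x, |φ x - ∫ y, φ y ∂Q| ^ s ∂Q ≤ 2 ^ s * (K + (1 + K) ^ s) := by
  have hφi := integrable_of_integrable_abs_rpow hφ hs hint
  have hmean : |∫ y, φ y ∂Q| ≤ 1 + K := by
    calc |∫ y, φ y ∂Q| ≤ ∫ y, |φ y| ∂Q := abs_integral_le_integral_abs
      _ ≤ ∫ y, (1 + |φ y| ^ s) ∂Q :=
          integral_mono hφi.abs ((integrable_const _).add hint) fun y => by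
            simpa using rpow_le_one_add_rpow (abs_nonneg (φ y)) zero_le_one hs
      _ ≤ 1 + K := by rw [integral_add (integrable_const _) hint]; simpa using hK
  calc ∫ x, |φ x - ∫ y, φ y ∂Q| ^ s ∂Q
      ≤ ∫ x, 2 ^ s * (|φ x| ^ s + |∫ y, φ y ∂Q| ^ s) ∂Q := by
        refine integral_mono_of_nonneg (.of_forall fun x => Real.rpow_nonneg (abs_nonneg _) s)
          ((hint.add (integrable_const _)).const_mul _) (.of_forall fun x => ?_)
        simpa [sub_eq_add_neg] using
          abs_add_rpow_le_two_rpow_mul (by linarith : 0 ≤ s) (φ x) (-∫ y, φ y ∂Q)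
    _ = 2 ^ s * (∫ x, |φ x| ^ s ∂Q + |∫ y, φ y ∂Q| ^ s) := by
        rw [integral_const_mul, integral_add hint (integrable_const _)]; simp
    _ ≤ _ := by gcongr

/-- Tail bound for the suprema of averages of functions of an i.i.d. sequence, uniform over
functions with a common bound for the absolute moment of order `s > 2`. -/
lemma exists_measure_mul_le_abs_sum_comp_le {X : ℕ → Ω → S} (X_meas : ∀ i, Measurable (X i))
    (X_indep : iIndepFun X P) (X_law : ∀ i, P.map (X i) = Q) {s : ℝ} (hs : 2 < s) {K : ℝ}
    (hK0 : 0 ≤ K) : ∃ A : ℝ, 0 ≤ A ∧ ∀ φ : S → ℝ, Measurable φ →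
      Integrable (fun x => |φ x| ^ s) Q → ∫ x, |φ x| ^ s ∂Q ≤ K →
      ∀ lam : ℝ, 0 < lam → ∀ n : ℕ, 1 ≤ n →
      P {ω | ∃ k, n ≤ k ∧ lam * k ≤ |∑ i ∈ Finset.range k, (φ (X i ω) - ∫ y, φ y ∂Q)|}
        ≤ ENNReal.ofReal (A * lam ^ (-s) * (n : ℝ) ^ (-(s / 2))) := by
  obtain ⟨B, hB0, hB⟩ := exists_integral_abs_sum_rpow_le P hs
    (by positivity : 0 ≤ 2 ^ s * (K + (1 + K) ^ s))
  refine ⟨2 * (B * 2 ^ (s / 2)), by positivity, fun φ hφ hint hK lam hlam n hn => ?_⟩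
  set ψ : S → ℝ := fun x => φ x - ∫ y, φ y ∂Q with hψdef
  have hψ : Measurable ψ := hφ.sub_const _
  have hφi := integrable_of_integrable_abs_rpow hφ (by linarith) hint
  have hψint : Integrable (fun x => |ψ x| ^ s) Q := by
    simpa [sub_eq_add_neg, hψdef] using integrable_abs_add_rpow hφ
      (measurable_const (a := -∫ y, φ y ∂Q)) (by linarith) hint (integrable_const _)
  have hψ0 : ∫ x, ψ x ∂Q = 0 := by
    rw [hψdef, integral_sub hφi (integrable_const _)]; simp
  have hψK := integral_abs_sub_integral_rpow_le hφ (by linarith) hint hK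
  have hY : ∀ i, Measurable fun ω => ψ (X i ω) := fun i => hψ.comp (X_meas i)
  have hind : iIndepFun (fun i ω => ψ (X i ω)) P := X_indep.comp (fun _ => ψ) fun _ => hψ
  have hYint : ∀ i, Integrable (fun ω => |ψ (X i ω)| ^ s) P := fun i => by
    rw [← X_law i] at hψint
    exact hψint.comp_measurable (X_meas i)
  have hY0 : ∀ i, ∫ ω, ψ (X i ω) ∂P = 0 := fun i => by
    rw [← integral_map (X_meas i).aemeasurable hψ.aestronglyMeasurable, X_law i, hψ0]
  have hYK : ∀ i, ∫ ω, |ψ (X i ω)| ^ s ∂P ≤ 2 ^ s * (K + (1 + K) ^ s) := fun i => by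
    rw [← integral_map (f := fun x => |ψ x| ^ s) (X_meas i).aemeasurable
      (hψ.abs.pow_const s).aestronglyMeasurable, X_law i]
    exact hψK
  exact measure_exists_mul_le_abs_sum_le hs.le hY hind hYint hY0 hB0
    (hB _ hY hind hYint hY0 hYK) hlam hn

omit [IsProbabilityMeasure Q] in
/-- Sign of the right derivative of the criterion function on both sides of a minimizing point. -/
lemma integral_rightDer_bounds {h : S → ℝ → ℝ} {t₀ : ℝ} (h_meas : ∀ t, Measurable fun x => h x t)
    (h_convex : ∀ x, ConvexOn ℝ univ (h x))
    (h_right : ∀ t, Integrable (fun x => rightDer (h x) t) Q) {m : ℝ}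
    (hm : m ∈ minimizers (criterion h t₀ Q)) {c δ : ℝ}
    (h_lower : ∀ x ∈ Icc (-δ) δ, c * |x| ≤ |rightDer (criterion h t₀ Q) (m + x)|)
    {x : ℝ} (hx : 0 < x) (hxδ : x ≤ δ) :
    c * x ≤ ∫ y, rightDer (h y) (m + x) ∂Q ∧ ∫ y, rightDer (h y) (m - x) ∂Q ≤ -(c * x) := by
  simp only [rightDer_criterion h_meas h_convex h_right] at h_lower
  constructor
  -- The subgradient inequality from m + x towards m, together with minimality of m, fixes the sign
  -- of the derivative, so the absolute value in `h_lower` can be dropped.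
  · have h1 := criterion_add_le h_meas h_convex h_right t₀ (m + x) m
    have h2 := hm (m + x)
    have h3 : 0 ≤ ∫ y, rightDer (h y) (m + x) ∂Q := by nlinarith
    have h4 := h_lower x ⟨by linarith, hxδ⟩
    rwa [abs_of_pos hx, abs_of_nonneg h3] at h4
  · have h1 := criterion_add_le h_meas h_convex h_right t₀ (m - x) m
    have h2 := hm (m - x)
    have h3 : ∫ y, rightDer (h y) (m - x) ∂Q ≤ 0 := by nlinarith
    have h4 := h_lower (-x) ⟨by linarith, by linarith⟩
    rw [abs_neg, abs_of_pos hx, ← sub_eq_add_neg, abs_of_nonpos h3] at h4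
    linarith

omit [MeasurableSpace S] [MeasurableSpace Ω] in
/-- If at `m ± x` the empirical right derivatives are close to values `G₁ ≥ lam` and
`G₂ ≤ -lam`, then the smallest minimizing point is within distance `x` of `m`. -/
lemma abs_sub_le_of_sum_rightDer {h : S → ℝ → ℝ} {t₀ : ℝ}
    (h_convex : ∀ x, ConvexOn ℝ univ (h x)) {X : ℕ → Ω → S} {k : ℕ} (hk : 1 ≤ k) {ω : Ω}
    {m x lam G₁ G₂ y : ℝ}
    (hy : ∀ t, IsLeast (minimizers (empCriterion h t₀ X k ω)) t → y = t)
    (hG₁ : lam ≤ G₁) (hG₂ : G₂ ≤ -lam)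
    (h₁ : |∑ i ∈ Finset.range k, (rightDer (h (X i ω)) (m + x) - G₁)| < lam * k)
    (h₂ : |∑ i ∈ Finset.range k, (rightDer (h (X i ω)) (m - x) - G₂)| < lam * k) :
    |y - m| ≤ x := by
  have hk' : (0 : ℝ) < k := by exact_mod_cast hk
  simp only [Finset.sum_sub_distrib, Finset.sum_const, Finset.card_range, nsmul_eq_mul] at h₁ h₂
  have hb : 0 < rightDer (empCriterion h t₀ X k ω) (m + x) := by
    rw [rightDer_empCriterion h_convex]
    refine mul_pos (inv_pos.2 hk') ?_
    nlinarith [(abs_lt.1 h₁).1]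
  have ha : rightDer (empCriterion h t₀ X k ω) (m - x) < 0 := by
    rw [rightDer_empCriterion h_convex]
    refine mul_neg_of_pos_of_neg (inv_pos.2 hk') ?_
    nlinarith [(abs_lt.1 h₂).2]
  obtain ⟨t, ht, hleast⟩ :=
    exists_isLeast_minimizers (convexOn_empCriterion h_convex t₀ X k ω) ha hb
  rw [hy t hleast, abs_le]
  constructor <;> linarith [ht.1, ht.2]

omit [IsProbabilityMeasure Q] [IsProbabilityMeasure P] in
/-- A uniform bound for the absolute moments of order `s` of the right derivatives. -/
lemma exists_integral_abs_rightDer_rpow_le {h : S → ℝ → ℝ}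
    (h_meas : ∀ t, Measurable fun x => h x t) (h_convex : ∀ x, ConvexOn ℝ univ (h x))
    {Z : Ω → S} (hZ : Measurable Z) (hlaw : P.map Z = Q) {m s x₀ : ℝ}
    (h_moment : (⨆ x ∈ Icc (-x₀) x₀,
      ∫⁻ ω, ENNReal.ofReal (|rightDer (h (Z ω)) (m + x)| ^ s) ∂P) < ∞) :
    ∃ K : ℝ, 0 ≤ K ∧ ∀ x ∈ Icc (-x₀) x₀,
      Integrable (fun y => |rightDer (h y) (m + x)| ^ s) Q ∧
        ∫ y, |rightDer (h y) (m + x)| ^ s ∂Q ≤ K := by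
  set L : ℝ≥0∞ := ⨆ x ∈ Icc (-x₀) x₀,
    ∫⁻ ω, ENNReal.ofReal (|rightDer (h (Z ω)) (m + x)| ^ s) ∂P
  refine ⟨L.toReal, ENNReal.toReal_nonneg, fun x hx => ?_⟩
  have hmeas : Measurable fun y => |rightDer (h y) (m + x)| ^ s :=
    (measurable_rightDer h_meas h_convex (m + x)).abs.pow_const s
  have hle : ∫⁻ y, ENNReal.ofReal (|rightDer (h y) (m + x)| ^ s) ∂Q ≤ L := by
    rw [← hlaw, lintegral_map hmeas.ennreal_ofReal hZ]
    exact le_iSup₂_of_le (f := fun x _ =>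
      ∫⁻ ω, ENNReal.ofReal (|rightDer (h (Z ω)) (m + x)| ^ s) ∂P) x hx le_rfl
  have hnn : ∀ y, 0 ≤ |rightDer (h y) (m + x)| ^ s := fun y => Real.rpow_nonneg (abs_nonneg _) s
  refine ⟨⟨hmeas.aestronglyMeasurable, ?_⟩, ?_⟩
  · rw [hasFiniteIntegral_iff_ofReal (.of_forall hnn)]
    exact hle.trans_lt h_moment
  · rw [integral_eq_lintegral_of_nonneg_ae (.of_forall hnn) hmeas.aestronglyMeasurable]
    exact ENNReal.toReal_mono h_moment.ne hle

end Deviation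

/-! ### Summation over the sample size and conclusion -/

lemma tsum_ofReal_rpow_lt_top {A p : ℝ} (hA : 0 ≤ A) (hp : p < -1) :
    ∑' n : ℕ, ENNReal.ofReal (A * ((n + 1 : ℕ) : ℝ) ^ p) < ∞ := by
  have h1 : Summable fun n : ℕ => A * ((n + 1 : ℕ) : ℝ) ^ p :=
    ((summable_nat_add_iff 1).2 (Real.summable_nat_rpow.2 hp)).mul_left A
  rw [← ENNReal.ofReal_tsum_of_nonneg (fun n => by positivity) h1]
  exact ENNReal.ofReal_lt_top

lemma exists_lt_abs_sub_of_lt_mul_supDev {Ω : Type*} {Y : ℕ → Ω → ℝ} {m ε a x : ℝ} {n : ℕ} {ω : Ω}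
    (ha : 0 ≤ a) (hax : a * x ≤ ε)
    (hlt : ENNReal.ofReal ε < ENNReal.ofReal a * supDev Y m n ω) :
    ∃ k, n ≤ k ∧ x < |Y k ω - m| := by
  by_contra! hcon
  have : supDev Y m n ω ≤ ENNReal.ofReal x :=
    iSup₂_le fun k hk => ENNReal.ofReal_le_ofReal (hcon k hk)
  refine not_le.2 hlt ?_
  calc _ ≤ ENNReal.ofReal a * ENNReal.ofReal x := by gcongr
    _ = ENNReal.ofReal (a * x) := (ENNReal.ofReal_mul ha).symm
    _ ≤ _ := ENNReal.ofReal_le_ofReal hax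

end ConvexMEstimation

theorem mainTheorem8
    {S Ω : Type*} [MeasurableSpace S] [MeasurableSpace Ω]
    (Q : Measure S) [IsProbabilityMeasure Q]
    (P : Measure Ω) [IsProbabilityMeasure P]
    -- the convex loss and the standing integrability of its one-sided derivatives
    (h : S → ℝ → ℝ) (t₀ : ℝ)
    (h_meas : ∀ t, Measurable fun x => h x t)
    (h_convex : ∀ x, ConvexOn ℝ univ (h x))
    (h_right : ∀ t, Integrable (fun x => ConvexMEstimation.rightDer (h x) t) Q)
    (h_left : ∀ t, Integrable (fun x => ConvexMEstimation.leftDer (h x) t) Q)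
    -- the i.i.d. observations with common distribution `Q`
    (X : ℕ → Ω → S)
    (X_meas : ∀ i, Measurable (X i))
    (X_indep : iIndepFun X P)
    (X_law : ∀ i, P.map (X i) = Q)
    -- `m` is a minimizing point of `M`
    (m : ℝ)
    (hm : m ∈ ConvexMEstimation.minimizers (ConvexMEstimation.criterion h t₀ Q))
    -- `mhat k ω` is the smallest minimizing point of `M_k`; at outcomes where `M_k` has none
    -- its value is left arbitrary
    (mhat : ℕ → Ω → ℝ)
    (h_mhat : ∀ k, 1 ≤ k → ∀ ω t,
      IsLeast (ConvexMEstimation.minimizers (ConvexMEstimation.empCriterion h t₀ X k ω)) t →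
        mhat k ω = t)
    -- the linear lower bound on `|D⁺M|` around `m`
    (c δ : ℝ) (hc : 0 < c) (hδ : 0 < δ)
    (h_lower : ∀ x ∈ Icc (-δ) δ,
      c * |x| ≤ |ConvexMEstimation.rightDer (ConvexMEstimation.criterion h t₀ Q) (m + x)|)
    -- the uniform moment bound of order `s > 2`
    (s x₀ : ℝ) (hs : 2 < s) (hx₀ : 0 < x₀)
    (h_moment : (⨆ x ∈ Icc (-x₀) x₀,
      ∫⁻ ω, ENNReal.ofReal (|ConvexMEstimation.rightDer (h (X 0 ω)) (m + x)| ^ s) ∂P) < ∞) :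
    -- `r < s / 2` follows from `r < (1 / 2 - γ) * s` if `0 ≤ γ`
    ∀ γ : ℝ, γ < 1 / 2 → ∀ r : ℝ, r < (1 / 2 - γ) * s → r < s / 2 →
      ConvexMEstimation.IsLittleORCompletely P r γ (ConvexMEstimation.supDev mhat m) := by
  intro γ hγ r hr hr2 ε hε
  obtain ⟨K, hK0, hK⟩ := ConvexMEstimation.exists_integral_abs_rightDer_rpow_le h_meas h_convex
    (X_meas 0) (X_law 0) h_moment
  obtain ⟨A, hA0, hA⟩ := ConvexMEstimation.exists_measure_mul_le_abs_sum_comp_le X_meas X_indep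
    X_law hs hK0
  obtain ⟨ρ, hρ, hρε, hρδ, hρx₀⟩ : ∃ ρ : ℝ, 0 < ρ ∧ ρ ≤ ε ∧ ρ ≤ δ ∧ ρ ≤ x₀ :=
    ⟨min ε (min δ x₀), lt_min hε (lt_min hδ hx₀), min_le_left _ _,
      (min_le_right _ _).trans (min_le_left _ _), (min_le_right _ _).trans (min_le_right _ _)⟩
  -- For γ < 0 the radius ε N^(-γ) would leave the neighbourhood of m where the hypotheses hold.
  -- Truncating γ at 0 keeps x ≤ ρ, and then r < s/2 is the condition that matters.
  set γ' : ℝ := max γ 0 with hγ'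
  have hrγ : r < (1 / 2 - γ') * s := by
    rcases max_choice γ 0 with h | h <;> rw [hγ', h] <;> linarith
  have hcρ : 0 < c * ρ := mul_pos hc hρ
  refine lt_of_le_of_lt (ENNReal.tsum_le_tsum fun n => ?_)
    (ConvexMEstimation.tsum_ofReal_rpow_lt_top (A := 2 * A * (c * ρ) ^ (-s))
      (p := r - 1 + (γ' * s - s / 2)) (by positivity) (by linarith))
  have hN1 : 1 ≤ n + 1 := by omega
  generalize n + 1 = N at hN1 ⊢
  have hN1' : (1 : ℝ) ≤ N := by exact_mod_cast hN1
  have hN : (0 : ℝ) < N := by linarith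
  set x : ℝ := ρ * (N : ℝ) ^ (-γ') with hxdef
  have hx : 0 < x := by positivity
  have hxρ : x ≤ ρ := mul_le_of_le_one_right hρ.le
    (Real.rpow_le_one_of_one_le_of_nonpos hN1' (neg_nonpos.2 (le_max_right _ _)))
  have hxε : (N : ℝ) ^ γ * x ≤ ε := by
    have h1 : (N : ℝ) ^ γ * x = ρ * (N : ℝ) ^ (γ - γ') := by
      rw [hxdef, sub_eq_add_neg, Real.rpow_add hN]; ring
    rw [h1]
    exact (mul_le_of_le_one_right hρ.le (Real.rpow_le_one_of_one_le_of_nonpos hN1'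
      (sub_nonpos.2 (le_max_left _ _)))).trans hρε
  obtain ⟨hG₁, hG₂⟩ := ConvexMEstimation.integral_rightDer_bounds h_meas h_convex h_right hm
    h_lower hx (hxρ.trans hρδ)
  have hbound : ∀ t, |t - m| ≤ x₀ → P {ω | ∃ k, N ≤ k ∧ c * x * k ≤
      |∑ i ∈ Finset.range k, (ConvexMEstimation.rightDer (h (X i ω)) t
        - ∫ y, ConvexMEstimation.rightDer (h y) t ∂Q)|}
      ≤ ENNReal.ofReal (A * (c * x) ^ (-s) * (N : ℝ) ^ (-(s / 2))) := fun t ht => by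
    obtain ⟨hint, hle⟩ := hK (t - m) (abs_le.1 ht)
    rw [add_sub_cancel] at hint hle
    exact hA _ (ConvexMEstimation.measurable_rightDer h_meas h_convex t) hint hle _
      (mul_pos hc hx) N hN1
  have hP : P {ω | ENNReal.ofReal ε <
      ENNReal.ofReal ((N : ℝ) ^ γ) * ConvexMEstimation.supDev mhat m N ω}
      ≤ ENNReal.ofReal (2 * (A * (c * x) ^ (-s) * (N : ℝ) ^ (-(s / 2)))) := by
    have hb₁ := hbound (m + x) (by
      rw [add_sub_cancel_left, abs_of_pos hx]; exact hxρ.trans hρx₀)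
    have hb₂ := hbound (m - x) (by
      rw [sub_sub_cancel_left, abs_neg, abs_of_pos hx]; exact hxρ.trans hρx₀)
    rw [two_mul, ENNReal.ofReal_add (by positivity) (by positivity)]
    -- Only monotonicity and subadditivity of the measure are used, so the deviation event need not
    -- be measurable.
    refine le_trans (measure_mono fun ω hω => ?_)
      ((measure_union_le _ _).trans (add_le_add hb₁ hb₂))
    obtain ⟨k, hNk, hk⟩ := ConvexMEstimation.exists_lt_abs_sub_of_lt_mul_supDev
      (by positivity) hxε hω
    by_contra hcon
    simp only [mem_union, mem_ofPred_eq, not_or, not_exists, not_and, not_le] at hcon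
    exact not_le.2 hk (ConvexMEstimation.abs_sub_le_of_sum_rightDer h_convex (hN1.trans hNk)
      (h_mhat k (hN1.trans hNk) ω) hG₁ hG₂ (hcon.1 k hNk) (hcon.2 k hNk))
  calc _ ≤ ENNReal.ofReal ((N : ℝ) ^ (r - 1))
        * ENNReal.ofReal (2 * (A * (c * x) ^ (-s) * (N : ℝ) ^ (-(s / 2)))) := by gcongr
    _ = ENNReal.ofReal (2 * A * (c * ρ) ^ (-s) * (N : ℝ) ^ (r - 1 + (γ' * s - s / 2))) := by
      rw [← ENNReal.ofReal_mul (by positivity)]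
      congr 1
      have h1 : (c * x) ^ (-s) = (c * ρ) ^ (-s) * (N : ℝ) ^ (γ' * s) := by
        rw [hxdef, ← mul_assoc, Real.mul_rpow hcρ.le (by positivity), ← Real.rpow_mul hN.le,
          neg_mul_neg]
      rw [h1, sub_eq_add_neg (γ' * s), Real.rpow_add hN, Real.rpow_add hN]
      ring
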